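/- Let $d$ be one of the integers $-1,-2,-3,-7,-11,-19,-43,-67,-163$, and let $R$ be the ring of algebraic integers of the imaginary quadratic number field $\mathbb{Q}(\sqrt d)\subset\mathbb{C}$. For a subset $H$ of $R$ and $a\in R$ put $H\dots a=\{(x,y)\in R\times R : xay\in H\}$, and let $$P_H=\{(a,b)\in R\times R : H\dots a=H\dots b\}$$ be the principal congruence on the multiplicative semigroup of $R$ defined by $H$. For $m\in R$ let $\tau_m$ be the relation on $R$ consisting of all pairs $(a,b)\in R\times R$ such that $\gcd(a,m)$ and $\gcd(b,m)$ exist in $R$ and are associated (greatest common divisors are taken with respect to divisibility in $R$, and are determined up to associates). Let $A$ be a nonzero ideal of $R$. Then there is a nonzero element $m$ of $R$ such that $P_A=\tau_m$. Moreover, there is a positive ordinary integer $n$ such that $P_{A\overline A}=\tau_n$, where $\overline A=\{\overline a : a\in A\}$ is the complex conjugate of $A$ and $A\overline A$ is the product of the ideals $A$ and $\overline A$. -/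

import Mathlib

open scoped NumberField IntermediateField

/-- For a subset `H` of a semigroup `S` and `a : S`, the set `H...a` of all pairs
`(x, y)` with `x * a * y ∈ H`. -/
def tripleDots {S : Type*} [Semigroup S] (H : Set S) (a : S) : Set (S × S) :=
  {p | p.1 * a * p.2 ∈ H}

/-- The principal congruence `P_H` on a semigroup `S` defined by a subset `H`, as a set of pairs. -/
def principalCongruence {S : Type*} [Semigroup S] (H : Set S) : Set (S × S) :=
  {p | tripleDots H p.1 = tripleDots H p.2}

/-- `g` is a greatest common divisor of `a` and `b`, with respect to divisibility. -/
def IsGreatestCommonDivisor {D : Type*} [CommRing D] (g a b : D) : Prop :=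
  g ∣ a ∧ g ∣ b ∧ ∀ c : D, c ∣ a → c ∣ b → c ∣ g

/-- The relation `τ_m`: the pairs `(a, b)` such that the greatest common divisors of `a, m` and
of `b, m` exist and are associated. Greatest common divisors are unique up to associates, so the
choice of `g` and `h` is immaterial. -/
def tau {D : Type*} [CommRing D] (m : D) : Set (D × D) :=
  {p | ∃ g h : D, IsGreatestCommonDivisor g p.1 m ∧ IsGreatestCommonDivisor h p.2 m ∧
    Associated g h}

/-- The quadratic number field `ℚ(√d)` as a subfield of `ℂ`. -/
noncomputable def quadraticField (d : ℤ) : IntermediateField ℚ ℂ :=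
  ℚ⟮(d : ℂ) ^ (1 / 2 : ℂ)⟯

/-- `ℚ(√d)` is stable under complex conjugation. -/
theorem conj_mem_quadraticField (d : ℤ) {z : ℂ} (hz : z ∈ quadraticField d) :
    starRingEnd ℂ z ∈ quadraticField d := by
  have hs : starRingEnd ℂ ((d : ℂ) ^ (1 / 2 : ℂ)) ∈ quadraticField d := by
    have h1 : ((d : ℂ) ^ (1 / 2 : ℂ)) ^ 2 = d := by
      simp
    have h2 : (starRingEnd ℂ ((d : ℂ) ^ (1 / 2 : ℂ))) ^ 2 = ((d : ℂ) ^ (1 / 2 : ℂ)) ^ 2 := by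
      rw [← map_pow, h1]
      simp
    have h3 : (d : ℂ) ^ (1 / 2 : ℂ) ∈ quadraticField d :=
      IntermediateField.mem_adjoin_simple_self ℚ _
    rcases sq_eq_sq_iff_eq_or_eq_neg.mp h2 with h | h
    · rw [h]; exact h3
    · rw [h]; exact neg_mem h3
  have hle : quadraticField d ≤
      (quadraticField d).comap (Complex.conjAe.toAlgHom.restrictScalars ℚ) := by
    refine IntermediateField.adjoin_le_iff.mpr ?_
    rintro x rfl
    exact hs
  exact hle hz

/-- Complex conjugation on the ring of integers of `ℚ(√d)`. -/
noncomputable def conjInt (d : ℤ) : 𝓞 (quadraticField d) →+* 𝓞 (quadraticField d) :=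
  NumberField.RingOfIntegers.mapRingHom
    (((starRingEnd ℂ).comp (quadraticField d).val.toRingHom).codRestrict
      (quadraticField d).toSubfield fun x => conj_mem_quadraticField d x.2)

theorem coe_conjInt (d : ℤ) (x : 𝓞 (quadraticField d)) :
    ((conjInt d x : quadraticField d) : ℂ) = starRingEnd ℂ ((x : quadraticField d) : ℂ) := rfl

theorem conjInt_conjInt (d : ℤ) (x : 𝓞 (quadraticField d)) : conjInt d (conjInt d x) = x := by
  apply NumberField.RingOfIntegers.ext
  apply Subtype.ext
  rw [coe_conjInt, coe_conjInt, Complex.conj_conj]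

/-- The complex conjugate `{ā : a ∈ A}` of an ideal `A` of the ring of integers of `ℚ(√d)`. -/
noncomputable def conjIdeal {d : ℤ} (A : Ideal (𝓞 (quadraticField d))) :
    Ideal (𝓞 (quadraticField d)) where
  carrier := {x | ∃ a ∈ A, conjInt d a = x}
  add_mem' := by
    rintro _ _ ⟨a, ha, rfl⟩ ⟨b, hb, rfl⟩
    exact ⟨a + b, A.add_mem ha hb, map_add _ _ _⟩
  zero_mem' := ⟨0, A.zero_mem, map_zero _⟩
  smul_mem' := by
    rintro r _ ⟨a, ha, rfl⟩
    refine ⟨conjInt d r * a, A.mul_mem_left _ ha, ?_⟩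
    rw [map_mul, conjInt_conjInt, smul_eq_mul]

/-! If `A = mR`, commutativity turns `P_A` into the relation "`m ∣ az` iff `m ∣ bz` for all `z`". By
Bézout, `a` may be replaced here by `gcd(a, m)`, and testing at complementary divisors of `m`
recovers that gcd up to associates; so `P_A = τ_m` (`principalCongruence_span_singleton`). Moreover
`A * conjIdeal A` is generated by the norm of `m`, a positive integer. It remains that `R` is
principal. This is the Dedekind–Hasse criterion (`exists_form_pos_lt_one`): for non-integral
coordinates, Dirichlet approximation gives a multiplier `s ≤ N` that brings the norm below 1. The
approximation error can vanish only if `s` is a denominator; then the inertness of the primes up to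
`N` supplies another multiplier. -/

/-! ### Principal congruences of principal ideals -/

/-- In a Bézout domain the greatest common divisors are the linear combinations which are
common divisors. -/
theorem IsGreatestCommonDivisor.exists_eq_add {D : Type*} [CommRing D] [IsBezout D]
    {g a m : D} (hg : IsGreatestCommonDivisor g a m) : ∃ r s : D, g = r * a + s * m := by
  have hgen := IsBezout.span_gcd a m
  have hdvd : IsBezout.gcd a m ∣ g := hg.2.2 _ (IsBezout.gcd_dvd_left a m)
    (IsBezout.gcd_dvd_right a m)
  have hmem : g ∈ Ideal.span {a, m} := by
    rw [← hgen]
    exact Ideal.mem_span_singleton.mpr hdvd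
  obtain ⟨r, s, h⟩ := Ideal.mem_span_pair.mp hmem
  exact ⟨r, s, h.symm⟩

theorem exists_isGreatestCommonDivisor {D : Type*} [CommRing D] [IsBezout D] (a m : D) :
    ∃ g : D, IsGreatestCommonDivisor g a m :=
  ⟨IsBezout.gcd a m, IsBezout.gcd_dvd_left a m, IsBezout.gcd_dvd_right a m,
    fun _ h₁ h₂ => IsBezout.dvd_gcd h₁ h₂⟩

theorem IsGreatestCommonDivisor.dvd_mul_iff {D : Type*} [CommRing D] [IsBezout D]
    {g a m : D} (hg : IsGreatestCommonDivisor g a m) (z : D) : m ∣ a * z ↔ m ∣ g * z := by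
  constructor
  · intro h
    obtain ⟨r, s, rfl⟩ := hg.exists_eq_add
    have : (r * a + s * m) * z = r * (a * z) + m * (s * z) := by ring
    rw [this]
    exact dvd_add (h.mul_left r) (dvd_mul_right _ _)
  · intro h
    exact h.trans (mul_dvd_mul_right hg.1 z)

theorem principalCongruence_span_singleton {D : Type*} [CommRing D] [IsDomain D] [IsBezout D]
    {m : D} (hm : m ≠ 0) :
    principalCongruence ((Ideal.span {m} : Ideal D) : Set D) = tau m := by
  ext ⟨a, b⟩
  have key : (a, b) ∈ principalCongruence ((Ideal.span {m} : Ideal D) : Set D) ↔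
      ∀ z : D, m ∣ a * z ↔ m ∣ b * z := by
    simp only [principalCongruence, tripleDots, Set.mem_ofPred_eq, Set.ext_iff, Prod.forall,
      SetLike.mem_coe, Ideal.mem_span_singleton]
    constructor
    · intro h z
      simpa using h 1 z
    · intro h x y
      rw [show x * a * y = a * (x * y) by ring, show x * b * y = b * (x * y) by ring]
      exact h _
  rw [key]
  constructor
  · intro h
    obtain ⟨g, hg⟩ := exists_isGreatestCommonDivisor a m
    obtain ⟨k, hk⟩ := exists_isGreatestCommonDivisor b m
    have h' : ∀ z : D, m ∣ g * z ↔ m ∣ k * z := fun z => by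
      rw [← hg.dvd_mul_iff, ← hk.dvd_mul_iff, h z]
    have aux : ∀ {u v : D}, u ∣ m → (∀ z : D, m ∣ u * z → m ∣ v * z) → u ∣ v := by
      rintro u v ⟨w, hw⟩ huv
      have hw0 : w ≠ 0 := by
        rintro rfl
        exact hm (by simpa using hw)
      -- The test element is the cofactor `w = m / u`, which cancels to leave `u ∣ v`.
      have h1 := huv w hw.dvd
      rw [hw] at h1
      exact (mul_dvd_mul_iff_right hw0).mp h1
    exact ⟨g, k, hg, hk, associated_of_dvd_dvd (aux hg.2.1 fun z => (h' z).mp)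
      (aux hk.2.1 fun z => (h' z).mpr)⟩
  · rintro ⟨g, k, hg, hk, hgk⟩ z
    rw [hg.dvd_mul_iff, hk.dvd_mul_iff]
    exact (hgk.mul_right z).dvd_iff_dvd_right

/-! ### The Dedekind–Hasse property of binary quadratic norm forms -/

/-- If the primes up to `N` do not divide primitive values of the form `x² + exy + qy²`, and `N` is
large with respect to its discriminant, then this form satisfies the Dedekind–Hasse criterion. -/
theorem exists_form_pos_lt_one {e q N : ℤ} (hN : 1 ≤ N) (hpos : 0 < 4 * q - e ^ 2)
    (hbound : 4 * q - e ^ 2 < 3 * (N + 1) ^ 2)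
    (hinert : ∀ p : ℕ, p.Prime → (p : ℤ) ≤ N → ∀ x y : ℤ,
      (p : ℤ) ∣ x ^ 2 + e * x * y + q * y ^ 2 → (p : ℤ) ∣ x ∧ (p : ℤ) ∣ y)
    (a b : ℚ) (hab : ¬ ∃ x y : ℤ, a = x ∧ b = y) :
    ∃ (u v x y : ℤ) (α β : ℚ), α = u * a - q * (v * b) - x ∧
      β = u * b + v * a + e * (v * b) - y ∧
      0 < α ^ 2 + e * α * β + q * β ^ 2 ∧ α ^ 2 + e * α * β + q * β ^ 2 < 1 := by
  have hposQ : (0 : ℚ) < 4 * q - e ^ 2 := by exact_mod_cast hpos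
  have hboundQ : (4 * q - e ^ 2 : ℚ) < 3 * (N + 1) ^ 2 := by exact_mod_cast hbound
  have hNQ : (1 : ℚ) ≤ N := by exact_mod_cast hN
  -- Dirichlet's theorem handles `b`. Rounding then centres the completed square, so the norm is at
  -- most `1/4 + (4q - e²) / (4(N+1)²)`, which `hbound` keeps below 1.
  obtain ⟨y, s, hs0, hsN, hsy⟩ := Real.exists_int_int_abs_mul_sub_le (b : ℝ) (n := N.toNat)
    (by omega)
  replace hsN : s ≤ N := by omega
  have hsy' : |s * b - y| ≤ 1 / ((N : ℚ) + 1) := by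
    have hc : ((N.toNat : ℕ) : ℝ) = (N : ℝ) := by
      have : ((N.toNat : ℕ) : ℤ) = N := Int.toNat_of_nonneg (by omega)
      exact_mod_cast this
    rw [hc] at hsy
    exact_mod_cast hsy
  set β : ℚ := s * b - y with hβ
  set x : ℤ := round (s * a + e * β / 2) with hx
  set α : ℚ := s * a - x with hα
  have hα' : |α + e * β / 2| ≤ 1 / 2 := by
    have := abs_sub_round (s * a + e * β / 2)
    rwa [← hx, show s * a + e * β / 2 - x = α + e * β / 2 by rw [hα]; ring] at this
  have hβ2 : β ^ 2 * (N + 1) ^ 2 ≤ 1 := by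
    have h1 : |β| * (N + 1) ≤ 1 := by
      rwa [le_div_iff₀ (by linarith)] at hsy'
    have h2 : (|β| * (N + 1)) ^ 2 ≤ 1 := pow_le_one₀ (by positivity) h1
    rwa [mul_pow, sq_abs] at h2
  have hα2 : (α + e * β / 2) ^ 2 ≤ 1 / 4 := by
    have := pow_le_pow_left₀ (abs_nonneg _) hα' 2
    rw [sq_abs] at this
    linarith
  have hform : ∀ α β : ℚ, α ^ 2 + e * α * β + q * β ^ 2 =
      (α + e * β / 2) ^ 2 + (4 * q - e ^ 2) / 4 * β ^ 2 := fun α β => by ring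
  have hlt : α ^ 2 + e * α * β + q * β ^ 2 < 1 := by
    rw [hform]
    rcases eq_or_ne β 0 with h0 | h0
    · rw [h0] at hα2 ⊢
      linarith
    · have : (4 * q - e ^ 2 : ℚ) * β ^ 2 < 3 * (N + 1) ^ 2 * β ^ 2 :=
        mul_lt_mul_of_pos_right hboundQ (by positivity)
      linarith
  by_cases hzero : α = 0 ∧ β = 0
  · -- here `s * (a, b)` is integral
    obtain ⟨hα0, hβ0⟩ := hzero
    have hex : ∃ n : ℕ, 0 < n ∧ (n : ℤ) ≤ N ∧ ∃ x y : ℤ, n * a = x ∧ n * b = y :=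
      ⟨s.toNat, by omega, by omega, x, y, by
        have : ((s.toNat : ℕ) : ℚ) = s := by
          exact_mod_cast Int.toNat_of_nonneg hs0.le
        rw [this]
        exact ⟨by linarith, by linarith⟩⟩
    classical
    -- For the least denominator `n = p * k`, the prime `p` cannot divide the norm of `x₀ + y₀ω`:
    -- inertness would make `k` a smaller denominator.
    obtain ⟨hn0, hnN, x₀, y₀, hx₀, hy₀⟩ := Nat.find_spec hex
    have hmin := fun {k : ℕ} => Nat.find_min hex (m := k)
    set n := Nat.find hex
    have hn1 : n ≠ 1 := by
      intro h
      rw [h] at hx₀ hy₀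
      exact hab ⟨x₀, y₀, by simpa using hx₀, by simpa using hy₀⟩
    obtain ⟨p, hp, k, hk⟩ := Nat.exists_prime_and_dvd hn1
    have hk0 : 0 < k := Nat.pos_of_ne_zero (by rintro rfl; simp at hk; omega)
    have hp2 := hp.two_le
    have hkn : k < n := by rw [hk]; nlinarith
    have hpN : (p : ℤ) ≤ N := by
      have : p ≤ n := by rw [hk]; nlinarith
      omega
    have hpQ : (p : ℚ) ≠ 0 := by exact_mod_cast hp.ne_zero
    have hnQ : (n : ℚ) = p * k := by exact_mod_cast hk
    have hndvd : ¬ (p : ℤ) ∣ x₀ ^ 2 + e * x₀ * y₀ + q * y₀ ^ 2 := by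
      intro h
      obtain ⟨⟨x₁, hx₁⟩, y₁, hy₁⟩ := hinert p hp hpN _ _ h
      refine hmin hkn ⟨hk0, by omega, x₁, y₁, ?_, ?_⟩
      · apply mul_left_cancel₀ hpQ
        rw [← mul_assoc, ← hnQ, hx₀, hx₁]
        push_cast; ring
      · apply mul_left_cancel₀ hpQ
        rw [← mul_assoc, ← hnQ, hy₀, hy₁]
        push_cast; ring
    -- Since `j` times the norm is `1 - i * p`, the product differs from `1 / p` by the integer `i`;
    -- this gives `α = 1 / p`, `β = 0`.
    obtain ⟨i, j, hij⟩ := ((Nat.prime_iff_prime_int.mp hp).coprime_iff_not_dvd).mpr hndvd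
    -- the multiplier is `j * k` times the conjugate of `x₀ + y₀ ω`
    have hka : (k : ℚ) * a = x₀ / p := by
      rw [eq_div_iff hpQ, ← hx₀, hnQ]; ring
    have hkb : (k : ℚ) * b = y₀ / p := by
      rw [eq_div_iff hpQ, ← hy₀, hnQ]; ring
    have hijQ : (i : ℚ) * p + j * (x₀ ^ 2 + e * x₀ * y₀ + q * y₀ ^ 2) = 1 := by
      exact_mod_cast hij
    refine ⟨j * k * (x₀ + e * y₀), -(j * k * y₀), -i, 0, 1 / p, 0, ?_, ?_, ?_, ?_⟩
    · push_cast
      have : (j * k * (x₀ + e * y₀) * a - q * (-(j * k * y₀) * b) - -i : ℚ) =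
          j * (x₀ + e * y₀) * (k * a) + q * j * y₀ * (k * b) + i := by ring
      rw [this, hka, hkb]
      field_simp
      linear_combination -hijQ
    · push_cast
      have : (j * k * (x₀ + e * y₀) * b + -(j * k * y₀) * a + e * (-(j * k * y₀) * b) - 0 : ℚ) =
          j * x₀ * (k * b) - j * y₀ * (k * a) := by ring
      rw [this, hka, hkb]
      ring
    · have : (0 : ℚ) < p := by exact_mod_cast hp.pos
      have : (0 : ℚ) < 1 / p := by positivity
      simp only [mul_zero, add_zero, ne_eq, OfNat.ofNat_ne_zero, not_false_eq_true, zero_pow]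
      positivity
    · have h2 : (2 : ℚ) ≤ p := by exact_mod_cast hp2
      have h3 : (1 : ℚ) / p < 1 := by
        rw [div_lt_one (by linarith)]; linarith
      simp only [mul_zero, add_zero, ne_eq, OfNat.ofNat_ne_zero, not_false_eq_true, zero_pow]
      exact pow_lt_one₀ (by positivity) h3 (by norm_num)
  · refine ⟨s, 0, x, y, α, β, by simp [hα], by simp [hβ], ?_, hlt⟩
    rw [hform]
    rcases eq_or_ne β 0 with h0 | h0
    · have : α ≠ 0 := fun h => hzero ⟨h, h0⟩
      rw [h0]
      simp only [mul_zero, zero_div, add_zero, ne_eq, OfNat.ofNat_ne_zero, not_false_eq_true,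
        zero_pow]
      positivity
    · positivity

/-! ### Coordinates on `ℚ(√d)` -/

/-- Integers `e`, `q` and an element `ω` of `ℚ(√d)` such that `ω² = eω - q` and `e - ω` is the complex
conjugate of `ω`, together with a bound `N` making the norm form `x² + exy + qy²` satisfy the
Dedekind–Hasse criterion. -/
structure IsHasseGenerator (d e q N : ℤ) (ω : ℂ) : Prop where
  one_le : 1 ≤ N
  pos : 0 < 4 * q - e ^ 2
  lt : 4 * q - e ^ 2 < 3 * (N + 1) ^ 2
  inert : ∀ p : ℕ, p.Prime → (p : ℤ) ≤ N → ∀ x y : ℤ,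
    (p : ℤ) ∣ x ^ 2 + e * x * y + q * y ^ 2 → (p : ℤ) ∣ x ∧ (p : ℤ) ∣ y
  mem : ω ∈ quadraticField d
  sq_eq : ω ^ 2 = e * ω - q
  conj_eq : starRingEnd ℂ ω = e - ω
  coords : ∀ z ∈ quadraticField d, ∃ a b : ℚ, z = a + b * ω

theorem sqrt_mem_quadraticField (d : ℤ) : (d : ℂ) ^ (1 / 2 : ℂ) ∈ quadraticField d :=
  IntermediateField.mem_adjoin_simple_self ℚ _

theorem cpow_half_sq (d : ℤ) : ((d : ℂ) ^ (1 / 2 : ℂ)) ^ 2 = d := by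
  simp

theorem exists_coords (d : ℤ) {z : ℂ} (hz : z ∈ quadraticField d) :
    ∃ a b : ℚ, z = a + b * (d : ℂ) ^ (1 / 2 : ℂ) := by
  have hint : IsAlgebraic ℚ ((d : ℂ) ^ (1 / 2 : ℂ)) := by
    refine IsIntegral.isAlgebraic (IsIntegral.of_pow (n := 2) (by norm_num) ?_)
    rw [cpow_half_sq]
    simpa using isIntegral_algebraMap (R := ℚ) (A := ℂ) (x := (d : ℚ))
  have hz' : z ∈ Algebra.adjoin ℚ {(d : ℂ) ^ (1 / 2 : ℂ)} := by
    rw [← IntermediateField.adjoin_simple_toSubalgebra_of_isAlgebraic hint]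
    exact hz
  clear hz
  induction hz' using Algebra.adjoin_induction with
  | mem x hx => exact ⟨0, 1, by rw [Set.mem_singleton_iff.mp hx]; simp⟩
  | algebraMap r => exact ⟨r, 0, by simp⟩
  | add x y _ _ hx hy =>
    obtain ⟨a, b, rfl⟩ := hx
    obtain ⟨a', b', rfl⟩ := hy
    exact ⟨a + a', b + b', by push_cast; ring⟩
  | mul x y _ _ hx hy =>
    obtain ⟨a, b, rfl⟩ := hx
    obtain ⟨a', b', rfl⟩ := hy
    refine ⟨a * a' + b * b' * d, a * b' + a' * b, ?_⟩
    push_cast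
    linear_combination (b * b' : ℂ) * cpow_half_sq d

theorem conj_cpow_half {d : ℤ} (hd : d < 0) :
    starRingEnd ℂ ((d : ℂ) ^ (1 / 2 : ℂ)) = -(d : ℂ) ^ (1 / 2 : ℂ) := by
  have h1 := cpow_half_sq d
  set δ := (d : ℂ) ^ (1 / 2 : ℂ)
  have h2 : (starRingEnd ℂ δ) ^ 2 = δ ^ 2 := by
    rw [← map_pow, h1]
    simp
  rcases sq_eq_sq_iff_eq_or_eq_neg.mp h2 with h | h
  · exfalso
    obtain ⟨r, hr⟩ := Complex.conj_eq_iff_real.mp h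
    rw [hr] at h1
    have h3 : r ^ 2 = (d : ℝ) := by exact_mod_cast h1
    have h4 : (d : ℝ) < 0 := by exact_mod_cast hd
    nlinarith [sq_nonneg r]
  · exact h

theorem isHasseGenerator_sqrt {d : ℤ} (hd : d < 0) (hd' : -3 < d) :
    IsHasseGenerator d 0 (-d) 1 ((d : ℂ) ^ (1 / 2 : ℂ)) where
  one_le := le_rfl
  pos := by omega
  lt := by omega
  inert p hp hp1 := by have := hp.two_le; omega
  mem := sqrt_mem_quadraticField d
  sq_eq := by rw [cpow_half_sq]; simp
  conj_eq := by rw [conj_cpow_half hd]; simp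
  coords _ hz := exists_coords d hz

theorem isHasseGenerator_half {d q N : ℤ} (hq : 0 < q) (hd : d = 1 - 4 * q) (hN : 1 ≤ N)
    (hlt : 4 * q - 1 < 3 * (N + 1) ^ 2)
    (hinert : ∀ p : ℕ, p.Prime → (p : ℤ) ≤ N → ∀ x y : ZMod p,
      x ^ 2 + x * y + q * y ^ 2 = 0 → x = 0 ∧ y = 0) :
    IsHasseGenerator d 1 q N ((1 + (d : ℂ) ^ (1 / 2 : ℂ)) / 2) where
  one_le := hN
  pos := by omega
  lt := by simpa using hlt
  inert p hp hpN x y h := by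
    simp only [← ZMod.intCast_zmod_eq_zero_iff_dvd] at h ⊢
    exact hinert p hp hpN x y (by simpa using h)
  mem := by
    refine div_mem (add_mem (one_mem _) (sqrt_mem_quadraticField d)) ?_
    exact ofNat_mem _ 2
  sq_eq := by
    have h := cpow_half_sq d
    have hd' : (d : ℂ) = 1 - 4 * q := by rw [hd]; push_cast; ring
    push_cast
    linear_combination (1 / 4 : ℂ) * h + (1 / 4 : ℂ) * hd'
  conj_eq := by
    rw [map_div₀, map_add, conj_cpow_half (by omega)]
    simp only [map_one, map_ofNat, Int.cast_one]
    ring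
  coords z hz := by
    obtain ⟨a, b, rfl⟩ := exists_coords d hz
    exact ⟨a - b, 2 * b, by push_cast; ring⟩

/-- In each case `N` is the least positive integer with `4q - e² < 3(N+1)²`. For `N = 1` inertness
is vacuous; otherwise only the primes 2, 3, 5, 7 occur, and `decide` checks that the form is
anisotropic modulo each. -/
theorem exists_isHasseGenerator {d : ℤ}
    (hd : d ∈ ({-1, -2, -3, -7, -11, -19, -43, -67, -163} : Set ℤ)) :
    ∃ (e q N : ℤ) (ω : ℂ), IsHasseGenerator d e q N ω := by
  simp only [Set.mem_insert_iff, Set.mem_singleton_iff] at hd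
  rcases hd with rfl | rfl | rfl | rfl | rfl | rfl | rfl | rfl | rfl
  · exact ⟨_, _, _, _, isHasseGenerator_sqrt (by norm_num) (by norm_num)⟩
  · exact ⟨_, _, _, _, isHasseGenerator_sqrt (by norm_num) (by norm_num)⟩
  · refine ⟨_, _, _, _, isHasseGenerator_half (q := 1) (N := 1) (by norm_num) (by norm_num)
      (by norm_num) (by norm_num) ?_⟩
    intro p hp hpN
    have := hp.two_le
    omega
  · refine ⟨_, _, _, _, isHasseGenerator_half (q := 2) (N := 1) (by norm_num) (by norm_num)
      (by norm_num) (by norm_num) ?_⟩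
    intro p hp hpN
    have := hp.two_le
    omega
  · refine ⟨_, _, _, _, isHasseGenerator_half (q := 3) (N := 1) (by norm_num) (by norm_num)
      (by norm_num) (by norm_num) ?_⟩
    intro p hp hpN
    have := hp.two_le
    omega
  · refine ⟨_, _, _, _, isHasseGenerator_half (q := 5) (N := 2) (by norm_num) (by norm_num)
      (by norm_num) (by norm_num) ?_⟩
    intro p hp hpN
    have := hp.two_le
    replace hpN : p ≤ 2 := by omega
    interval_cases p
    decide
  · refine ⟨_, _, _, _, isHasseGenerator_half (q := 11) (N := 3) (by norm_num) (by norm_num)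
      (by norm_num) (by norm_num) ?_⟩
    intro p hp hpN
    have := hp.two_le
    replace hpN : p ≤ 3 := by omega
    interval_cases p <;> decide
  · refine ⟨_, _, _, _, isHasseGenerator_half (q := 17) (N := 4) (by norm_num) (by norm_num)
      (by norm_num) (by norm_num) ?_⟩
    intro p hp hpN
    have := hp.two_le
    replace hpN : p ≤ 4 := by omega
    interval_cases p
    · decide
    · decide
    · exact absurd hp (by norm_num)
  · refine ⟨_, _, _, _, isHasseGenerator_half (q := 41) (N := 7) (by norm_num) (by norm_num)
      (by norm_num) (by norm_num) ?_⟩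
    intro p hp hpN
    have := hp.two_le
    replace hpN : p ≤ 7 := by omega
    interval_cases p
    · decide
    · decide
    · exact absurd hp (by norm_num)
    · decide
    · exact absurd hp (by norm_num)
    · decide

/-! ### The ring of integers is a principal ideal domain -/

namespace IsHasseGenerator

variable {d e q N : ℤ} {ω : ℂ}

theorem mul_conj (h : IsHasseGenerator d e q N ω) (a b : ℚ) :
    (a + b * ω) * starRingEnd ℂ (a + b * ω) =
      ((a ^ 2 + e * a * b + q * b ^ 2 : ℚ) : ℂ) := by
  have ha : starRingEnd ℂ (a : ℂ) = a := map_ratCast _ a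
  have hb : starRingEnd ℂ (b : ℂ) = b := map_ratCast _ b
  rw [map_add, map_mul, h.conj_eq, ha, hb]
  push_cast
  linear_combination (-(b : ℂ) ^ 2) * h.sq_eq

theorem normSq_eq (h : IsHasseGenerator d e q N ω) (a b : ℚ) :
    Complex.normSq (a + b * ω) = ((a ^ 2 + e * a * b + q * b ^ 2 : ℚ) : ℝ) := by
  have := h.mul_conj a b
  rw [Complex.mul_conj] at this
  exact_mod_cast this

theorem isIntegral (h : IsHasseGenerator d e q N ω) : IsIntegral ℤ ω := by
  refine ⟨Polynomial.X ^ 2 - (Polynomial.C e * Polynomial.X - Polynomial.C q), ?_, ?_⟩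
  · monicity!
  · simp [h.sq_eq, -eq_intCast]

/-- Only the inclusion `ℤ[ω] ⊆ R` is needed; equality is never used. -/
theorem exists_coe_eq (h : IsHasseGenerator d e q N ω) (x y : ℤ) :
    ∃ r : 𝓞 (quadraticField d), ((r : quadraticField d) : ℂ) = x + y * ω := by
  have hmem : (x + y * ω : ℂ) ∈ quadraticField d :=
    add_mem (intCast_mem _ x) (mul_mem (intCast_mem _ y) h.mem)
  have hint : IsIntegral ℤ (x + y * ω : ℂ) :=
    (isIntegral_algebraMap (x := x)).add ((isIntegral_algebraMap (x := y)).mul h.isIntegral)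
  have hint' : IsIntegral ℤ (⟨_, hmem⟩ : quadraticField d) :=
    (isIntegral_algHom_iff ((quadraticField d).val.restrictScalars ℤ)
      (quadraticField d).val.injective).mp hint
  exact ⟨⟨_, hint'⟩, rfl⟩

/-- The norm `z * conj z` of an algebraic integer of `ℚ(√d)` is an ordinary integer. -/
theorem exists_mul_conjInt_eq (h : IsHasseGenerator d e q N ω) (z : 𝓞 (quadraticField d)) :
    ∃ n : ℕ, z * conjInt d z = n := by
  obtain ⟨a, b, hab⟩ := h.coords _ (z : quadraticField d).2
  have hz : (((z * conjInt d z : 𝓞 (quadraticField d)) : quadraticField d) : ℂ) =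
      ((a ^ 2 + e * a * b + q * b ^ 2 : ℚ) : ℂ) := by
    rw [← h.mul_conj, ← hab, ← coe_conjInt]
    rfl
  have hint : IsIntegral ℤ (((z * conjInt d z : 𝓞 (quadraticField d)) : quadraticField d) : ℂ) :=
    (NumberField.RingOfIntegers.isIntegral_coe (z * conjInt d z)).map
      ((quadraticField d).val.restrictScalars ℤ)
  rw [hz] at hint
  have hint' : IsIntegral ℤ (a ^ 2 + e * a * b + q * b ^ 2 : ℚ) :=
    (isIntegral_algHom_iff ((Algebra.ofId ℚ ℂ).restrictScalars ℤ)
      (algebraMap ℚ ℂ).injective).mp hint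
  -- The norm is rational by its coordinates and integral over `ℤ`, hence an integer.
  obtain ⟨k, hk⟩ := IsIntegrallyClosed.isIntegral_iff.mp hint'
  have hk0 : 0 ≤ k := by
    have h1 := h.normSq_eq a b
    rw [← hk] at h1
    have h2 := Complex.normSq_nonneg ((a : ℂ) + b * ω)
    rw [h1] at h2
    simpa using h2
  refine ⟨k.toNat, ?_⟩
  apply NumberField.RingOfIntegers.ext
  apply Subtype.ext
  rw [hz, ← hk]
  have : ((k.toNat : ℕ) : ℂ) = (k : ℂ) := by exact_mod_cast Int.toNat_of_nonneg hk0
  simp [← this]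

theorem exists_normSq_eq (h : IsHasseGenerator d e q N ω) (z : 𝓞 (quadraticField d)) :
    ∃ n : ℕ, Complex.normSq ((z : quadraticField d) : ℂ) = n := by
  obtain ⟨n, hn⟩ := h.exists_mul_conjInt_eq z
  refine ⟨n, ?_⟩
  have h1 : ((z : quadraticField d) : ℂ) * starRingEnd ℂ ((z : quadraticField d) : ℂ) = n := by
    rw [← coe_conjInt]
    exact congrArg (fun w : 𝓞 (quadraticField d) => ((w : quadraticField d) : ℂ)) hn
  rw [Complex.mul_conj] at h1
  exact_mod_cast h1

/-- A nonzero `g ∈ I` of least norm generates `I`: if `z / g` had non-integral coordinates, some `s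
* z - t * g` in `I` would be nonzero of smaller norm. -/
theorem isPrincipalIdealRing (h : IsHasseGenerator d e q N ω) :
    IsPrincipalIdealRing (𝓞 (quadraticField d)) := by
  refine ⟨fun I => ?_⟩
  rcases eq_or_ne I ⊥ with rfl | hI
  · infer_instance
  let ι : 𝓞 (quadraticField d) →+* ℂ :=
    (algebraMap (quadraticField d) ℂ).comp (algebraMap (𝓞 (quadraticField d)) (quadraticField d))
  have hι : Function.Injective ι := (algebraMap (quadraticField d) ℂ).injective.comp
    NumberField.RingOfIntegers.coe_injective
  choose f hf using h.exists_normSq_eq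
  replace hf : ∀ z, Complex.normSq (ι z) = f z := hf
  obtain ⟨g, ⟨hgI, hg0⟩, hmin⟩ := (measure f).wf.has_min {z | z ∈ I ∧ z ≠ 0}
    (Submodule.exists_mem_ne_zero_of_ne_bot hI)
  refine ⟨g, le_antisymm (fun z hz => ?_) ((Ideal.span_singleton_le_iff_mem I).mpr hgI)⟩
  have hg0' : ι g ≠ 0 := (map_ne_zero_iff ι hι).mpr hg0
  obtain ⟨a, b, hab⟩ := h.coords (ι z / ι g)
    (div_mem (z : quadraticField d).2 (g : quadraticField d).2)
  rw [div_eq_iff hg0'] at hab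
  apply Ideal.mem_span_singleton.mpr
  by_cases hint : ∃ x y : ℤ, a = x ∧ b = y
  · obtain ⟨x, y, rfl, rfl⟩ := hint
    obtain ⟨r, hr⟩ := h.exists_coe_eq x y
    refine ⟨r, hι ?_⟩
    replace hr : ι r = x + y * ω := hr
    rw [map_mul, hab, hr]
    push_cast; ring
  · exfalso
    obtain ⟨u, v, x, y, α, β, hα, hβ, hpos, hlt⟩ :=
      exists_form_pos_lt_one h.one_le h.pos h.lt h.inert a b hint
    obtain ⟨s, hs⟩ := h.exists_coe_eq u v
    obtain ⟨t, ht⟩ := h.exists_coe_eq x y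
    replace hs : ι s = u + v * ω := hs
    replace ht : ι t = x + y * ω := ht
    have hw : ι (s * z - t * g) = (α + β * ω) * ι g := by
      rw [map_sub, map_mul, map_mul, hab, hs, ht, hα, hβ]
      push_cast
      linear_combination (v * b * ι g : ℂ) * h.sq_eq
    have hgpos := Complex.normSq_pos.mpr hg0'
    have hnorm : (f (s * z - t * g) : ℝ) =
        ((α ^ 2 + e * α * β + q * β ^ 2 : ℚ) : ℝ) * f g := by
      rw [← hf, hw, Complex.normSq_mul, h.normSq_eq, hf]
    rw [hf] at hgpos
    have hpos' : (0 : ℝ) < ((α ^ 2 + e * α * β + q * β ^ 2 : ℚ) : ℝ) := by exact_mod_cast hpos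
    have hlt' : ((α ^ 2 + e * α * β + q * β ^ 2 : ℚ) : ℝ) < 1 := by exact_mod_cast hlt
    refine hmin (s * z - t * g) ⟨I.sub_mem (I.mul_mem_left _ hz) (I.mul_mem_left _ hgI), ?_⟩ ?_
    · intro h0
      have h1 : (0 : ℝ) < f (s * z - t * g) := by
        rw [hnorm]
        positivity
      rw [← hf, h0] at h1
      simp at h1
    · change f _ < f g
      have h1 : (f (s * z - t * g) : ℝ) < f g := by
        rw [hnorm]
        exact mul_lt_of_lt_one_left hgpos hlt'
      exact_mod_cast h1

end IsHasseGenerator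

theorem conjIdeal_span_singleton {d : ℤ} (m : 𝓞 (quadraticField d)) :
    conjIdeal (Ideal.span {m}) = Ideal.span {conjInt d m} := by
  ext x
  change (∃ a ∈ Ideal.span {m}, conjInt d a = x) ↔ _
  simp only [Ideal.mem_span_singleton]
  constructor
  · rintro ⟨a, ha, rfl⟩
    exact map_dvd _ ha
  · rintro ⟨c, rfl⟩
    exact ⟨m * conjInt d c, dvd_mul_right _ _, by rw [map_mul, conjInt_conjInt]⟩

theorem mainTheorem4 (d : ℤ)
    (hd : d ∈ ({-1, -2, -3, -7, -11, -19, -43, -67, -163} : Set ℤ))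
    (A : Ideal (𝓞 (quadraticField d))) (hA : A ≠ ⊥) :
    (∃ m : 𝓞 (quadraticField d), m ≠ 0 ∧
      principalCongruence (A : Set (𝓞 (quadraticField d))) = tau m) ∧
    (∃ n : ℕ, 0 < n ∧
      principalCongruence
          ((A * conjIdeal A : Ideal (𝓞 (quadraticField d))) : Set (𝓞 (quadraticField d))) =
        tau (n : 𝓞 (quadraticField d))) := by
  obtain ⟨e, q, N, ω, h⟩ := exists_isHasseGenerator hd
  have := h.isPrincipalIdealRing
  obtain ⟨m, rfl⟩ := (IsPrincipalIdealRing.principal A).principal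
  change Ideal.span {m} ≠ ⊥ at hA
  have hm : m ≠ 0 := fun h0 => hA (by rw [h0, Ideal.span_singleton_zero])
  refine ⟨⟨m, hm, principalCongruence_span_singleton hm⟩, ?_⟩
  obtain ⟨n, hn⟩ := h.exists_mul_conjInt_eq m
  have hconj : conjInt d m ≠ 0 := fun h0 => hm (by rw [← conjInt_conjInt d m, h0, map_zero])
  have hn0 : (n : 𝓞 (quadraticField d)) ≠ 0 := hn ▸ mul_ne_zero hm hconj
  refine ⟨n, Nat.pos_of_ne_zero fun h0 => hn0 (by rw [h0, Nat.cast_zero]), ?_⟩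
  change principalCongruence (((Ideal.span {m} * conjIdeal (Ideal.span {m}) :
    Ideal (𝓞 (quadraticField d)))) : Set (𝓞 (quadraticField d))) = _
  rw [conjIdeal_span_singleton, Ideal.span_singleton_mul_span_singleton, hn]
  exact principalCongruence_span_singleton hn0
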